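/- **Theorem.** Fix integers $1\le m\le n$, a set $X$ of records, and reals $T,t$, $\varepsilon>0$, $\Delta>0$. A dataset is a finite multiset of records, and two datasets are *neighbouring* if one arises from the other by replacing one record (so they have the same size). Let $f_1,\dots,f_q$ be real-valued queries on datasets whose sensitivity is at most $\Delta$ on datasets of size $m$ and on datasets of size $n$, i.e. $|f_i(D)-f_i(D')|\le\Delta$ for all neighbouring $D,D'$ of either size. Put $\varepsilon'=\ln\!\big(\tfrac nm(e^{\varepsilon/2}-1)+1\big)$ and write $\mathrm{Lap}(b)$ for a Laplace variable with density $\tfrac1{2b}e^{-|x|/b}$; all noise is drawn independently. Consider the following *one-off sieve-and-examine mechanism* on a dataset $D$ with $n$ records. 1. (Sieve.) Draw a uniformly random sub-dataset $D'$ of $m$ of the $n$ records, without replacement. Run AboveThreshold on $D'$: let $\hat T=T-t+\mathrm{Lap}(2\Delta/\varepsilon')$ and let $k$ be the first index $i$ with $f_i(D')+\mathrm{Lap}(4\Delta/\varepsilon')\ge\hat T$ (fresh noise for each $i$). If there is no such $i$, output $\bot$ and halt. 2. (Examine.) If $f_k(D)+\mathrm{Lap}(2\Delta/\varepsilon)\ge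 T$, output $k$; otherwise output $\bot$. A randomized algorithm $A$ is $\varepsilon$-differentially private if $\Pr[A(D)\in S]\le e^{\varepsilon}\Pr[A(D')\in S]$ for all neighbouring input datasets $D,D'$ and all sets $S$ of outputs. Then the one-off sieve-and-examine mechanism is $\varepsilon$-differentially private on datasets with $n$ records. Moreover, AboveThreshold as used in step 1 is $\varepsilon'$-differentially private on datasets with $m$ records; the sieve step (subsampling followed by AboveThreshold, returning the index found or $\bot$) is $\varepsilon/2$-differentially private on datasets with $n$ records; and for each fixed $k$ the examine step is $\varepsilon/2$-differentially private on datasets with $n$ records. -/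

import Mathlib

open MeasureTheory
open scoped ENNReal

noncomputable section

namespace SieveExamine

/-! ### Datasets, sensitivity and differential privacy -/

/-- A dataset with `n` records from `X`: a multiset of cardinality `n`. -/
abbrev Dataset (X : Type*) (n : ℕ) : Type _ := Sym X n

/-- Two datasets (of the same size) are neighbouring if one is obtained from the other by
replacing one record. -/
def Neighboring {X : Type*} {n : ℕ} (D D' : Dataset X n) : Prop :=
  ∃ (E : Multiset X) (a b : X), (D : Multiset X) = a ::ₘ E ∧ (D' : Multiset X) = b ::ₘ E

/-- On datasets with `n` records, the sensitivity of the real query `f` is at most `Δ`. -/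
def SensitivityLE {X : Type*} (n : ℕ) (f : Multiset X → ℝ) (Δ : ℝ) : Prop :=
  ∀ D D' : Dataset X n, Neighboring D D' →
    |f (D : Multiset X) - f (D' : Multiset X)| ≤ Δ

/-- `(ε, δ)`-differential privacy of a randomized algorithm `A`, given by the law `A D` of its
output on each dataset `D`. (`toOuterMeasure S` is the probability of `S`.) -/
def IsDP {X R : Type*} {n : ℕ} (A : Dataset X n → PMF R) (ε δ : ℝ) : Prop :=
  ∀ D D' : Dataset X n, Neighboring D D' → ∀ S : Set R,
    (A D).toOuterMeasure S ≤
      ENNReal.ofReal (Real.exp ε) * (A D').toOuterMeasure S + ENNReal.ofReal δ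

/-- `ε`-differential privacy (pure differential privacy). -/
def IsPureDP {X R : Type*} {n : ℕ} (A : Dataset X n → PMF R) (ε : ℝ) : Prop :=
  IsDP A ε 0

/-! ### Noise -/

/-- The centred Laplace distribution `Lap(b)`, with density `exp (-|x| / b) / (2 b)`, for `0 < b`
(and the point mass at `0` otherwise). -/
def laplace (b : ℝ) : Measure ℝ :=
  if 0 < b then
    volume.withDensity fun x => ENNReal.ofReal (Real.exp (-|x| / b) / (2 * b))
  else Measure.dirac 0

theorem integrable_exp_neg_abs_div {b : ℝ} (hb : 0 < b) :
    Integrable (fun x : ℝ => Real.exp (-|x| / b)) ∧ ∫ x : ℝ, Real.exp (-|x| / b) = 2 * b := by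
  have h1 : ∫ x : ℝ, Real.exp (-|x| / b) = 2 * b := by
    have h := integral_comp_abs (f := fun x : ℝ => Real.exp (-x / b))
    rw [h]
    have h2 : ∫ x in Set.Ioi (0 : ℝ), Real.exp (-x / b) = b := by
      have h3 := integral_exp_mul_Ioi (a := -b⁻¹) (by simpa using hb) 0
      simp only [mul_zero, Real.exp_zero] at h3
      calc ∫ x in Set.Ioi (0 : ℝ), Real.exp (-x / b)
          = ∫ x in Set.Ioi (0 : ℝ), Real.exp (-b⁻¹ * x) := by
            congr 1; ext x; congr 1; ring
        _ = b := by rw [h3]; field_simp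
    rw [h2]
  refine ⟨?_, h1⟩
  by_contra hn
  rw [integral_undef hn] at h1
  linarith

instance isProbabilityMeasure_laplace (b : ℝ) : IsProbabilityMeasure (laplace b) := by
  unfold laplace
  split_ifs with hb
  · obtain ⟨hi, hv⟩ := integrable_exp_neg_abs_div hb
    constructor
    rw [withDensity_apply _ MeasurableSet.univ, Measure.restrict_univ,
      ← ofReal_integral_eq_lintegral_ofReal (hi.div_const _)
        (Filter.Eventually.of_forall fun x => by positivity),
      integral_div, hv, div_self (by positivity), ENNReal.ofReal_one]
  · infer_instance

/-- The law, as a probability mass function, of a random variable `Y` with countably many values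
on the probability space `(Ω, μ)`. -/
def lawOf {Ω R : Type*} [MeasurableSpace Ω] [Countable R] (μ : Measure Ω)
    [IsProbabilityMeasure μ] (Y : Ω → R) (hY : ∀ r, MeasurableSet (Y ⁻¹' {r})) : PMF R :=
  ⟨fun r => μ (Y ⁻¹' {r}), by
    rw [ENNReal.summable.hasSum_iff,
      ← measure_iUnion (fun r s hrs => Set.disjoint_left.2 fun ω hr hs =>
        hrs (by rw [← (hr : Y ω = r), ← (hs : Y ω = s)])) hY]
    have h : (⋃ r, Y ⁻¹' {r}) = Set.univ := by ext ω; simp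
    rw [h, measure_univ]⟩

/-! ### The mechanism -/

/-- The loop over the queries `0, 1, …, q - 1`: the first `i` such that the noisy answer
`a i + ν i` reaches the noisy threshold `T + ρ`, or `none` if there is none. -/
def firstAbove {q : ℕ} (a : Fin q → ℝ) (T : ℝ) (ω : ℝ × (Fin q → ℝ)) : Option (Fin q) :=
  Fin.find? fun i => decide (T + ω.1 ≤ a i + ω.2 i)

theorem measurableSet_firstAbove {q : ℕ} (a : Fin q → ℝ) (T : ℝ) (r : Option (Fin q)) :
    MeasurableSet (firstAbove a T ⁻¹' {r}) := by
  have hle : ∀ i : Fin q, MeasurableSet {ω : ℝ × (Fin q → ℝ) | T + ω.1 ≤ a i + ω.2 i} :=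
    fun i => measurableSet_le (by fun_prop) (by fun_prop)
  cases r with
  | none =>
    have h : firstAbove a T ⁻¹' {none} =
        ⋂ i, {ω : ℝ × (Fin q → ℝ) | T + ω.1 ≤ a i + ω.2 i}ᶜ := by
      ext ω; simp [firstAbove]
    rw [h]
    exact MeasurableSet.iInter fun i => (hle i).compl
  | some k =>
    have h : firstAbove a T ⁻¹' {some k} =
        {ω : ℝ × (Fin q → ℝ) | T + ω.1 ≤ a k + ω.2 k} ∩
          ⋂ i, ⋂ (_ : i < k), {ω : ℝ × (Fin q → ℝ) | T + ω.1 ≤ a i + ω.2 i}ᶜ := by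
      ext ω; simp [firstAbove]
    rw [h]
    exact (hle k).inter (MeasurableSet.iInter fun i => MeasurableSet.iInter fun _ => (hle i).compl)

/-- The sparse vector technique halting at the first above-threshold query (AboveThreshold) with
privacy parameter `ε'`: independent noise `Lap(2Δ/ε')` on the threshold `T` and `Lap(4Δ/ε')` on
each query answer. Returns the index of the first query found above the threshold, or `none`. -/
def aboveThreshold {X : Type*} {q : ℕ} (f : Fin q → Multiset X → ℝ) (T ε' Δ : ℝ)
    (D : Multiset X) : PMF (Option (Fin q)) :=
  lawOf ((laplace (2 * Δ / ε')).prod (Measure.pi fun _ : Fin q => laplace (4 * Δ / ε')))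
    (firstAbove (fun i => f i D) T) (measurableSet_firstAbove _ _)

/-- A uniformly random sub-dataset of `m` of the `n` records, drawn without replacement
(`Multiset.powersetCard` lists all choices of `m` of the `n` records, with multiplicity). -/
def subsample {X : Type*} {n : ℕ} (m : ℕ) (hmn : m ≤ n) (D : Dataset X n) : PMF (Multiset X) :=
  PMF.ofMultiset ((D : Multiset X).powersetCard m) (by
    rw [← Multiset.card_pos, Multiset.card_powersetCard, Sym.card_coe]
    exact Nat.choose_pos hmn)

/-- `ε' = ln ((n / m) (e^{ε/2} - 1) + 1)`. -/
def sieveEps (n m : ℕ) (ε : ℝ) : ℝ :=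
  Real.log ((n : ℝ) / m * (Real.exp (ε / 2) - 1) + 1)

/-- The sieve step: AboveThreshold on a random subsample of size `m`, with the tweaked threshold
`T - t` and the parameter `ε'`. -/
def sieve {X : Type*} {n q : ℕ} (f : Fin q → Multiset X → ℝ) (T t : ℝ) (m : ℕ) (hmn : m ≤ n)
    (ε Δ : ℝ) (D : Dataset X n) : PMF (Option (Fin q)) :=
  (subsample m hmn D).bind fun D' => aboveThreshold f (T - t) (sieveEps n m ε) Δ D'

/-- The examine step for query `k`: output `k` if `f k D + Lap(2Δ/ε) ≥ T`, otherwise `none`. -/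
def examine {X : Type*} {n q : ℕ} (f : Fin q → Multiset X → ℝ) (T ε Δ : ℝ) (k : Fin q)
    (D : Dataset X n) : PMF (Option (Fin q)) :=
  lawOf (laplace (2 * Δ / ε)) (fun η => if T ≤ f k (D : Multiset X) + η then some k else none)
    (by
      intro r
      have h : Measurable[_, ⊤] fun η : ℝ =>
          if T ≤ f k (D : Multiset X) + η then some k else none :=
        Measurable.ite (measurableSet_le (by fun_prop) (by fun_prop))
          measurable_const measurable_const
      exact h trivial)

/-- The one-off sieve-and-examine mechanism; `none` is the output `⊥`, given also when no query
passes the sieve. -/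
def sieveAndExamine {X : Type*} {n q : ℕ} (f : Fin q → Multiset X → ℝ) (T t : ℝ) (m : ℕ)
    (hmn : m ≤ n) (ε Δ : ℝ) (D : Dataset X n) : PMF (Option (Fin q)) :=
  (sieve f T t m hmn ε Δ D).bind fun r =>
    match r with
    | none => PMF.pure none
    | some k => examine f T ε Δ k D

end SieveExamine

end

namespace SieveExamine

/-! ### Pure differential privacy, pointwise -/

/-! Translating Laplace noise of scale `b` by `s` changes probabilities by a factor of at most `exp
(|s| / b)` (`lintegral_laplace_le`). So each noisy step is private once a translation carries the
noise producing an output on `D` to noise producing it on `D'`. The examine step shifts one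
variable; AboveThreshold shifts the threshold noise and the noise of the reported query.

For subsampling, let `L = exp ε'` and let the neighbours be `E` plus `a` and `E` plus `b`. Let `U`,
`V`, `W` be the mean probabilities of an output over samples avoiding the replaced record,
containing `a`, and containing `b`. Swapping one record gives `V ≤ L * W` and, if `m < n`, `V ≤ L *
U`. With `p = m / n`, comparing with `min U W` gives `(1 - p) * U + p * V ≤ (1 + p * (L - 1)) * ((1
- p) * U + p * W)`. The choice of `ε'` makes this factor `exp (ε / 2)`, and composition with the
examine step adds the other `ε / 2`. -/

theorem IsPureDP.of_pointwise {X R : Type*} {n : ℕ} {A : Dataset X n → PMF R} {ε : ℝ}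
    (h : ∀ D D' : Dataset X n, Neighboring D D' → ∀ r,
      A D r ≤ ENNReal.ofReal (Real.exp ε) * A D' r) : IsPureDP A ε := by
  intro D D' hD S
  rw [ENNReal.ofReal_zero, add_zero, PMF.toOuterMeasure_apply, PMF.toOuterMeasure_apply,
    ← ENNReal.tsum_mul_left]
  refine ENNReal.tsum_le_tsum fun r => ?_
  by_cases hr : r ∈ S
  · simpa [hr] using h D D' hD r
  · simp [hr]

theorem IsPureDP.apply_le {X R : Type*} {n : ℕ} {A : Dataset X n → PMF R} {ε : ℝ}
    (h : IsPureDP A ε) {D D' : Dataset X n} (hD : Neighboring D D') (r : R) :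
    A D r ≤ ENNReal.ofReal (Real.exp ε) * A D' r := by
  simpa [PMF.toOuterMeasure_apply_singleton] using h D D' hD {r}

/-- Adaptive composition. -/
theorem IsPureDP.bind {X R S : Type*} {n : ℕ} {A : Dataset X n → PMF R}
    {B : R → Dataset X n → PMF S} {ε₁ ε₂ : ℝ} (hA : IsPureDP A ε₁)
    (hB : ∀ r, IsPureDP (B r) ε₂) :
    IsPureDP (fun D => (A D).bind fun r => B r D) (ε₁ + ε₂) := by
  refine .of_pointwise fun D D' hD s => ?_
  rw [PMF.bind_apply, PMF.bind_apply, ← ENNReal.tsum_mul_left, Real.exp_add,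
    ENNReal.ofReal_mul (Real.exp_pos _).le]
  refine ENNReal.tsum_le_tsum fun r => ?_
  refine (mul_le_mul' (hA.apply_le hD r) ((hB r).apply_le hD s)).trans (le_of_eq ?_)
  ring

theorem isPureDP_const {X R : Type*} {n : ℕ} (p : PMF R) {ε : ℝ} (hε : 0 ≤ ε) :
    IsPureDP (fun _ : Dataset X n => p) ε := by
  refine .of_pointwise fun D D' _ r => le_mul_of_one_le_left' ?_
  simpa using hε

theorem Neighboring.symm {X : Type*} {n : ℕ} {D D' : Dataset X n} (h : Neighboring D D') :
    Neighboring D' D := by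
  obtain ⟨E, a, b, h₁, h₂⟩ := h
  exact ⟨E, b, a, h₂, h₁⟩

theorem lawOf_apply {Ω R : Type*} [MeasurableSpace Ω] [Countable R] (μ : Measure Ω)
    [IsProbabilityMeasure μ] (Y : Ω → R) (hY : ∀ r, MeasurableSet (Y ⁻¹' {r})) (r : R) :
    lawOf μ Y hY r = μ (Y ⁻¹' {r}) := rfl

/-! ### Shifts of Laplace noise -/

theorem lintegral_laplace_le {b : ℝ} (hb : 0 < b) (s : ℝ) {g : ℝ → ℝ≥0∞} (hg : Measurable g) :
    ∫⁻ x, g x ∂laplace b ≤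
      ENNReal.ofReal (Real.exp (|s| / b)) * ∫⁻ x, g (x + s) ∂laplace b := by
  have hd : Measurable fun x : ℝ => ENNReal.ofReal (Real.exp (-|x| / b) / (2 * b)) := by fun_prop
  have hgs : Measurable fun x => g (x + s) := by fun_prop
  rw [laplace, if_pos hb, lintegral_withDensity_eq_lintegral_mul _ hd hg,
    lintegral_withDensity_eq_lintegral_mul _ hd hgs, ← lintegral_const_mul _ (hd.mul hgs),
    ← lintegral_add_right_eq_self _ s]
  refine lintegral_mono fun x => ?_
  simp only [Pi.mul_apply]
  rw [← mul_assoc, ← ENNReal.ofReal_mul (Real.exp_pos _).le, ← mul_div_assoc, ← Real.exp_add]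
  gcongr
  rw [← add_div]
  gcongr
  have := abs_sub_abs_le_abs_sub x (x + s)
  rw [sub_add_cancel_left, abs_neg] at this
  linarith

theorem lintegral_pi_laplace_le {ι : Type*} [Fintype ι] [DecidableEq ι] {b : ℝ} (hb : 0 < b)
    (k : ι) (s : ℝ) {g : (ι → ℝ) → ℝ≥0∞} (hg : Measurable g) :
    ∫⁻ x, g x ∂(Measure.pi fun _ : ι => laplace b) ≤
      ENNReal.ofReal (Real.exp (|s| / b)) *
        ∫⁻ x, g (Function.update x k (x k + s)) ∂(Measure.pi fun _ : ι => laplace b) := by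
  have hu : Measurable fun x : ι → ℝ => Function.update x k (x k + s) := by
    refine measurable_pi_lambda _ fun i => ?_
    by_cases hi : i = k
    · subst hi; simpa using by fun_prop
    · simpa [hi] using measurable_pi_apply i
  have hgu : Measurable fun x => g (Function.update x k (x k + s)) := hg.comp hu
  rw [← lintegral_const_mul _ hgu]
  -- Only coordinate `k` moves, so it suffices to compare integrals over it with the others frozen.
  refine lintegral_le_of_lmarginal_le {k} hg (hgu.const_mul _) fun x => ?_
  rw [lmarginal_singleton, lmarginal_singleton]
  simp only [Function.update_idem, Function.update_self]
  rw [lintegral_const_mul _ (by fun_prop)]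
  exact lintegral_laplace_le hb s (g := fun y => g (Function.update x k y)) (by fun_prop)

/-- The translation bound in coupling form: a shift by `s` pulls `A` back into `B`. -/
theorem laplace_apply_le {b : ℝ} (hb : 0 < b) (s : ℝ) {A B : Set ℝ} (hA : MeasurableSet A)
    (h : ∀ x, x + s ∈ A → x ∈ B) :
    laplace b A ≤ ENNReal.ofReal (Real.exp (|s| / b)) * laplace b B := by
  rw [← lintegral_indicator_one hA]
  refine (lintegral_laplace_le hb s (measurable_one.indicator hA)).trans ?_
  gcongr
  refine (lintegral_mono fun x => ?_).trans (lintegral_indicator_one_le B)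
  by_cases hx : x + s ∈ A
  · simp [hx, h x hx]
  · simp [hx]

theorem laplace_prod_pi_laplace_apply_le {ι : Type*} [Fintype ι] [DecidableEq ι] {b c : ℝ}
    (hb : 0 < b) (hc : 0 < c) (s u : ℝ) (k : ι) {A B : Set (ℝ × (ι → ℝ))}
    (hA : MeasurableSet A)
    (h : ∀ x : ℝ × (ι → ℝ), (x.1 + s, Function.update x.2 k (x.2 k + u)) ∈ A → x ∈ B) :
    (laplace b).prod (Measure.pi fun _ : ι => laplace c) A ≤
      ENNReal.ofReal (Real.exp (|s| / b + |u| / c)) *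
        (laplace b).prod (Measure.pi fun _ : ι => laplace c) B := by
  have hu : Measurable fun x : ι → ℝ => Function.update x k (x k + u) := by
    refine measurable_pi_lambda _ fun i => ?_
    by_cases hi : i = k
    · subst hi; simpa using by fun_prop
    · simpa [hi] using measurable_pi_apply i
  have hg : Measurable (A.indicator (1 : ℝ × (ι → ℝ) → ℝ≥0∞)) := measurable_one.indicator hA
  have hgu : Measurable fun x : ℝ × (ι → ℝ) =>
      A.indicator (1 : ℝ × (ι → ℝ) → ℝ≥0∞) (x.1, Function.update x.2 k (x.2 k + u)) :=
    hg.comp (measurable_fst.prodMk (hu.comp measurable_snd))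
  have hgsu : Measurable fun x : ℝ × (ι → ℝ) =>
      A.indicator (1 : ℝ × (ι → ℝ) → ℝ≥0∞) (x.1 + s, Function.update x.2 k (x.2 k + u)) :=
    hg.comp ((measurable_fst.add_const s).prodMk (hu.comp measurable_snd))
  calc (laplace b).prod (Measure.pi fun _ : ι => laplace c) A
      = ∫⁻ x, ∫⁻ y, A.indicator 1 (x, y) ∂(Measure.pi fun _ : ι => laplace c) ∂laplace b := by
        rw [← lintegral_indicator_one hA, lintegral_prod _ hg.aemeasurable]
    _ ≤ ∫⁻ x, ENNReal.ofReal (Real.exp (|u| / c)) *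
          ∫⁻ y, A.indicator 1 (x, Function.update y k (y k + u))
            ∂(Measure.pi fun _ : ι => laplace c) ∂laplace b :=
        lintegral_mono fun x => lintegral_pi_laplace_le hc k u
          (g := fun y => A.indicator 1 (x, y)) (hg.comp measurable_prodMk_left)
    _ = ENNReal.ofReal (Real.exp (|u| / c)) *
          ∫⁻ x, ∫⁻ y, A.indicator 1 (x, Function.update y k (y k + u))
            ∂(Measure.pi fun _ : ι => laplace c) ∂laplace b :=
        lintegral_const_mul _ hgu.lintegral_prod_right'
    _ ≤ ENNReal.ofReal (Real.exp (|u| / c)) * (ENNReal.ofReal (Real.exp (|s| / b)) *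
          ∫⁻ x, ∫⁻ y, A.indicator 1 (x + s, Function.update y k (y k + u))
            ∂(Measure.pi fun _ : ι => laplace c) ∂laplace b) := by
        gcongr
        exact lintegral_laplace_le hb s hgu.lintegral_prod_right'
    _ = ENNReal.ofReal (Real.exp (|s| / b + |u| / c)) *
          ∫⁻ x, A.indicator 1 (x.1 + s, Function.update x.2 k (x.2 k + u))
            ∂((laplace b).prod (Measure.pi fun _ : ι => laplace c)) := by
        rw [lintegral_prod _ hgsu.aemeasurable, ← mul_assoc,
          ← ENNReal.ofReal_mul (Real.exp_pos _).le, ← Real.exp_add, add_comm]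
    _ ≤ _ := by
        gcongr
        refine (lintegral_mono fun x => ?_).trans (lintegral_indicator_one_le B)
        by_cases hx : (x.1 + s, Function.update x.2 k (x.2 k + u)) ∈ A
        · simp [hx, h x hx]
        · simp [hx]

/-! ### AboveThreshold and the examine step -/

theorem firstAbove_eq_some_iff {q : ℕ} {a : Fin q → ℝ} {T : ℝ} {ω : ℝ × (Fin q → ℝ)}
    {k : Fin q} : firstAbove a T ω = some k ↔
      T + ω.1 ≤ a k + ω.2 k ∧ ∀ i < k, a i + ω.2 i < T + ω.1 := by
  simp [firstAbove]

theorem firstAbove_eq_none_iff {q : ℕ} {a : Fin q → ℝ} {T : ℝ} {ω : ℝ × (Fin q → ℝ)} :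
    firstAbove a T ω = none ↔ ∀ i, a i + ω.2 i < T + ω.1 := by
  simp [firstAbove]

theorem isPureDP_aboveThreshold {X : Type*} {m q : ℕ} (f : Fin q → Multiset X → ℝ)
    (T : ℝ) {ε Δ : ℝ} (hε : 0 < ε) (hΔ : 0 < Δ) (hf : ∀ i, SensitivityLE m (f i) Δ) :
    IsPureDP (fun D : Dataset X m => aboveThreshold f T ε Δ (D : Multiset X)) ε := by
  refine .of_pointwise fun D D' hD r => ?_
  simp only [aboveThreshold, lawOf_apply]
  have hb : 0 < 2 * Δ / ε := by positivity
  have hc : 0 < 4 * Δ / ε := by positivity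
  have hs : |(-Δ)| / (2 * Δ / ε) = ε / 2 := by
    rw [abs_neg, abs_of_pos hΔ]; field_simp
  have hu : |(-(2 * Δ))| / (4 * Δ / ε) = ε / 2 := by
    rw [abs_neg, abs_of_pos (by positivity)]; field_simp; norm_num
  have hle : ∀ i, |f i D - f i D'| ≤ Δ := fun i => hf i D D' hD
  have hA := measurableSet_firstAbove (fun i => f i D) T r
  cases r with
  | some k =>
    -- Lowering the threshold by `Δ` absorbs the change of every earlier answer, so these stay below
    -- it on `D'`. Query `k` must then make up `Δ` for the threshold and `Δ` for its own change,
    -- hence `2 * Δ`. Each shift costs `ε / 2`.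
    have h := laplace_prod_pi_laplace_apply_le hb hc (-Δ) (-(2 * Δ)) k hA
      (B := firstAbove (fun i => f i D') T ⁻¹' {some k}) ?_
    · rwa [hs, hu, add_halves] at h
    · intro x hx
      simp only [Set.mem_preimage, Set.mem_singleton_iff, firstAbove_eq_some_iff,
        Function.update_self] at hx ⊢
      refine ⟨by linarith [(abs_le.1 (hle k)).2], fun i hi => ?_⟩
      have := hx.2 i hi
      rw [Function.update_of_ne hi.ne] at this
      linarith [(abs_le.1 (hle i)).1]
  | none =>
    -- The shift lemma needs some coordinate, even for a zero shift, so the case of no queries is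
    -- separate.
    cases q with
    | zero =>
      have hall : ∀ a : Fin 0 → ℝ, firstAbove a T ⁻¹' {none} = Set.univ := fun a => by
        ext ω; simp [firstAbove]
      rw [hall, hall]
      exact le_mul_of_one_le_left' (by simpa using hε.le)
    | succ q =>
      -- With no query reported, the threshold shift alone suffices.
      have h := laplace_prod_pi_laplace_apply_le hb hc (-Δ) 0 0 hA
        (B := firstAbove (fun i => f i D') T ⁻¹' {none}) ?_
      · rw [hs, abs_zero, zero_div, add_zero] at h
        refine h.trans ?_
        gcongr
        linarith
      · intro x hx
        simp only [Set.mem_preimage, Set.mem_singleton_iff, firstAbove_eq_none_iff, add_zero,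
          Function.update_eq_self] at hx ⊢
        intro i
        linarith [hx i, (abs_le.1 (hle i)).1]

theorem isPureDP_examine {X : Type*} {n q : ℕ} (f : Fin q → Multiset X → ℝ) (T : ℝ)
    {ε Δ : ℝ} (hε : 0 < ε) (hΔ : 0 < Δ) (k : Fin q) (hf : SensitivityLE n (f k) Δ) :
    IsPureDP (fun D : Dataset X n => examine f T ε Δ k D) (ε / 2) := by
  refine .of_pointwise fun D D' hD r => ?_
  have hb : 0 < 2 * Δ / ε := by positivity
  have hbound : |f k D' - f k D| / (2 * Δ / ε) ≤ ε / 2 := by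
    rw [div_le_iff₀ hb]
    refine (hf D' D hD.symm).trans (le_of_eq ?_)
    field_simp
  simp only [examine, lawOf_apply]
  -- This shift makes the two noisy answers equal, so the outputs agree exactly.
  refine (laplace_apply_le hb (f k D' - f k D)
    (B := (fun η => if T ≤ f k (D' : Multiset X) + η then some k else none) ⁻¹' {r})
    ?_ fun x hx => ?_).trans ?_
  · have h : Measurable[_, ⊤] fun η : ℝ =>
        if T ≤ f k (D : Multiset X) + η then some k else none :=
      Measurable.ite (measurableSet_le (by fun_prop) (by fun_prop))
        measurable_const measurable_const
    exact h trivial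
  · have e : f k (D : Multiset X) + (x + (f k D' - f k D)) = f k D' + x := by ring
    simpa only [Set.mem_preimage, e] using hx
  · gcongr

/-! ### Privacy amplification by subsampling -/

/-- Every sub-multiset `R` of `E` of size `j` extends in `card E - j` ways to one of size
`j + 1`. -/
theorem powersetCard_succ_bind_powersetCard {X : Type*} (E : Multiset X) (j : ℕ) :
    (E.powersetCard (j + 1)).bind (Multiset.powersetCard j) =
      (Multiset.card E - j) • E.powersetCard j := by
  induction E using Multiset.induction generalizing j with
  | empty => rw [Multiset.powersetCard_zero_right]; simp
  | cons a E ih =>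
    cases j with
    | zero =>
      simp [Multiset.powersetCard_zero_left, Multiset.bind, Multiset.map_const',
        Multiset.powersetCard_one, Multiset.join, Multiset.nsmul_singleton]
      rw [add_comm, Multiset.singleton_add]
    | succ j =>
      have hself : (E.powersetCard (j + 1)).bind (Multiset.powersetCard (j + 1)) =
          E.powersetCard (j + 1) := by
        conv_rhs => rw [← Multiset.bind_singleton (s := E.powersetCard (j + 1)) (f := id) |>.trans
          (Multiset.map_id _)]
        refine Multiset.bind_congr fun R hR => ?_
        rw [← (Multiset.mem_powersetCard.1 hR).2, Multiset.powersetCard_self]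
        rfl
      rw [Multiset.powersetCard_cons, Multiset.add_bind, ih, Multiset.bind_map]
      simp only [Multiset.powersetCard_cons, Multiset.bind_add]
      rw [hself, ← Multiset.map_bind, ih, Multiset.map_nsmul, Multiset.card_cons,
        Nat.add_sub_add_right, nsmul_add, ← add_assoc]
      congr 1
      -- The truncated subtraction is harmless: when `card E ≤ j` there are no sub-multisets of size
      -- `j + 1`.
      rcases lt_or_ge j (Multiset.card E) with h | h
      · rw [← succ_nsmul]
        congr 1
        omega
      · rw [Multiset.powersetCard_eq_empty _ (by omega)]
        simp

/-- Double counting of pairs `R ≤ S` with sizes `j` and `j + 1`: each `R` has `card E - j`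
extensions, each `S` has `j + 1` choices of `R`, and `S` differs from `a ::ₘ R` by one swapped
record. -/
theorem sum_map_powersetCard_mul_le {X : Type*} {E : Multiset X} {j : ℕ} {a : X}
    (hj : j ≤ Multiset.card E) {G : Multiset X → ℝ} {L : ℝ}
    (hG : ∀ R, Multiset.card R = j → ∀ x y, G (x ::ₘ R) ≤ L * G (y ::ₘ R)) :
    ((Multiset.card E : ℝ) - j) * ((E.powersetCard j).map fun R => G (a ::ₘ R)).sum ≤
      (j + 1) * (L * ((E.powersetCard (j + 1)).map G).sum) := by
  have h := congrArg (fun s => (s.map fun R => G (a ::ₘ R)).sum)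
    (powersetCard_succ_bind_powersetCard E j)
  simp only [Multiset.map_bind, Multiset.sum_bind, Multiset.map_nsmul, Multiset.sum_nsmul,
    nsmul_eq_mul, Nat.cast_sub hj] at h
  rw [← h, ← mul_assoc, ← Multiset.sum_map_mul_left]
  refine Multiset.sum_map_le_sum_map _ _ fun S hS => ?_
  have hcard := (Multiset.mem_powersetCard.1 hS).2
  have hle : ∀ r ∈ (S.powersetCard j).map fun R => G (a ::ₘ R), r ≤ L * G S := by
    intro r hr
    obtain ⟨R, hR, rfl⟩ := Multiset.mem_map.1 hr
    obtain ⟨hRS, hRc⟩ := Multiset.mem_powersetCard.1 hR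
    obtain ⟨U, rfl⟩ := Multiset.le_iff_exists_add.1 hRS
    rw [Multiset.card_add, hRc, Nat.add_left_cancel_iff, Multiset.card_eq_one] at hcard
    obtain ⟨x, rfl⟩ := hcard
    rw [Multiset.add_comm, Multiset.singleton_add]
    exact hG R hRc a x
  refine (Multiset.sum_le_card_nsmul _ _ hle).trans (le_of_eq ?_)
  rw [Multiset.card_map, Multiset.card_powersetCard, hcard, Nat.choose_succ_self_right,
    nsmul_eq_mul]
  push_cast
  ring

/-- Here `u`, `v`, `w` are unnormalised sums over samples without the replaced record, with its old
value, and with its new value. -/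
theorem add_le_amplified {n m u v w L : ℝ} (hm : 0 < m) (hmn : m ≤ n) (hu : 0 ≤ u)
    (hL : 1 ≤ L) (hvw : v ≤ L * w) (hvu : (n - m) * v ≤ m * (L * u)) :
    u + v ≤ (1 + m / n * (L - 1)) * (u + w) := by
  have hn : 0 < n := hm.trans_le hmn
  have hmain : n * (v - w) ≤ m * (L - 1) * (u + w) := by
    have hL' : 0 ≤ L - 1 := sub_nonneg.2 hL
    -- This decides which of the means of `w` and `u` is smaller; the hypothesis bounding `v` by the
    -- smaller one is used.
    rcases le_or_gt ((n - m) * w) (m * u) with h | h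
    · have h₁ := mul_le_mul_of_nonneg_left h hL'
      have h₂ := mul_le_mul_of_nonneg_left hvw hn.le
      linarith
    · have hlt : 0 < n - m := by
        refine (sub_nonneg.2 hmn).lt_of_ne fun h0 => ?_
        rw [← h0, zero_mul] at h
        exact (mul_nonneg hm.le hu).not_gt h
      refine le_of_mul_le_mul_left ?_ hlt
      -- After multiplication by `n - m` and substitution of `hvu`, both `m * u` and `(n - m) * w`
      -- carry the coefficient `m * (L - 1) + n`.
      have h₁ := mul_le_mul_of_nonneg_left h.le (by positivity : 0 ≤ m * (L - 1) + n)
      have h₂ := mul_le_mul_of_nonneg_left hvu hn.le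
      linarith
  have h : (1 + m / n * (L - 1)) * (u + w) = u + w + m * (L - 1) * (u + w) / n := by
    field_simp
  rw [h]
  have := (le_div_iff₀' hn).2 hmain
  linarith

theorem sum_map_powersetCard_cons_le {X : Type*} {E : Multiset X} {m : ℕ} {a b : X} (hm : 0 < m)
    (hmE : m ≤ Multiset.card E + 1) {G : Multiset X → ℝ} {L : ℝ} (hG₀ : ∀ S, 0 ≤ G S)
    (hL : 1 ≤ L)
    (hG : ∀ R, Multiset.card R + 1 = m → ∀ x y, G (x ::ₘ R) ≤ L * G (y ::ₘ R)) :
    (((a ::ₘ E).powersetCard m).map G).sum ≤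
      (1 + (m : ℝ) / (Multiset.card E + 1 : ℕ) * (L - 1)) *
        (((b ::ₘ E).powersetCard m).map G).sum := by
  obtain ⟨j, rfl⟩ := Nat.exists_eq_succ_of_ne_zero hm.ne'
  have hG' : ∀ R, Multiset.card R = j → ∀ x y, G (x ::ₘ R) ≤ L * G (y ::ₘ R) :=
    fun R hR => hG R (by rw [hR])
  simp only [Nat.succ_eq_add_one, Multiset.powersetCard_cons, Multiset.map_add,
    Multiset.sum_add, Multiset.map_map, Function.comp_def]
  refine add_le_amplified (by positivity) (by exact_mod_cast hmE) ?_ hL ?_ ?_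
  · refine Multiset.sum_nonneg fun r hr => ?_
    obtain ⟨S, -, rfl⟩ := Multiset.mem_map.1 hr
    exact hG₀ S
  · rw [← Multiset.sum_map_mul_left]
    exact Multiset.sum_map_le_sum_map _ _ fun R hR =>
      hG' R (Multiset.mem_powersetCard.1 hR).2 a b
  · have := sum_map_powersetCard_mul_le (a := a) (by omega : j ≤ Multiset.card E) hG'
    push_cast
    linarith

/-- Passing to real sums makes subtraction available for the amplification inequality. -/
theorem ofMultiset_bind_apply {α β : Type*} (s : Multiset α) (hs : s ≠ 0) (g : α → PMF β)
    (r : β) : (PMF.ofMultiset s hs).bind g r =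
      ENNReal.ofReal ((s.map fun x => (g x r).toReal).sum / Multiset.card s) := by
  classical
  have hcard : (0 : ℝ) < Multiset.card s := by exact_mod_cast Multiset.card_pos.2 hs
  rw [PMF.bind_apply, tsum_eq_sum (s := s.toFinset) fun x hx => by
    rw [PMF.ofMultiset_apply_of_notMem _ (by simpa using hx), zero_mul],
    Finset.sum_multiset_map_count, Finset.sum_div,
    ENNReal.ofReal_sum_of_nonneg fun x _ => by positivity]
  refine Finset.sum_congr rfl fun x _ => ?_
  rw [PMF.ofMultiset_apply, ENNReal.ofReal_div_of_pos hcard, nsmul_eq_mul,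
    ENNReal.ofReal_mul (by positivity), ENNReal.ofReal_natCast, ENNReal.ofReal_natCast,
    ENNReal.ofReal_toReal (PMF.apply_ne_top _ _), ENNReal.mul_div_right_comm]

/-- Privacy amplification by subsampling without replacement, for neighbouring datasets that
differ in the value of one record. -/
theorem IsPureDP.subsample_bind {X R : Type*} {n m : ℕ} (hm : 0 < m) (hmn : m ≤ n)
    {A : Multiset X → PMF R} {ε : ℝ} (hε : 0 ≤ ε)
    (hA : IsPureDP (fun D : Dataset X m => A (D : Multiset X)) ε) :
    IsPureDP (fun D : Dataset X n => (subsample m hmn D).bind A)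
      (Real.log (1 + (m : ℝ) / n * (Real.exp ε - 1))) := by
  have hL : 1 ≤ Real.exp ε := Real.one_le_exp hε
  have hpos : 0 < 1 + (m : ℝ) / n * (Real.exp ε - 1) := by
    have := sub_nonneg.2 hL
    positivity
  refine .of_pointwise fun D D' ⟨E, a, b, hD, hD'⟩ r => ?_
  have hn : Multiset.card E + 1 = n := by
    rw [← Multiset.card_cons a, ← hD, Sym.card_coe]
  rw [Real.exp_log hpos, subsample, subsample, ofMultiset_bind_apply, ofMultiset_bind_apply,
    ← ENNReal.ofReal_mul hpos.le, ← mul_div_assoc, Multiset.card_powersetCard,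
    Multiset.card_powersetCard, Sym.card_coe, Sym.card_coe, hD, hD']
  gcongr
  subst hn
  refine sum_map_powersetCard_cons_le hm hmn (fun S => ENNReal.toReal_nonneg) hL
    fun S hS x y => ?_
  have h := hA.apply_le (D := ⟨x ::ₘ S, by rw [Multiset.card_cons, hS]⟩)
    (D' := ⟨y ::ₘ S, by rw [Multiset.card_cons, hS]⟩) ⟨S, x, y, rfl, rfl⟩ r
  have h' := ENNReal.toReal_mono
    (ENNReal.mul_ne_top ENNReal.ofReal_ne_top (PMF.apply_ne_top _ _)) h
  rwa [ENNReal.toReal_mul, ENNReal.toReal_ofReal (Real.exp_pos _).le] at h'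

/-! ### Calibration of `ε'` and composition of the two steps. -/

theorem sieveEps_pos {n m : ℕ} (hm : 0 < m) (hmn : m ≤ n) {ε : ℝ} (hε : 0 < ε) :
    0 < sieveEps n m ε := by
  have hn : 0 < n := hm.trans_le hmn
  have : 0 < Real.exp (ε / 2) - 1 := sub_pos.2 (Real.one_lt_exp_iff.2 (by positivity))
  refine Real.log_pos ?_
  have : 0 < (n : ℝ) / m * (Real.exp (ε / 2) - 1) := by positivity
  linarith

/-- `sieveEps` inverts the amplification map at `ε / 2`. -/
theorem log_amplified_sieveEps {n m : ℕ} (hm : 0 < m) (hmn : m ≤ n) {ε : ℝ} (hε : 0 < ε) :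
    Real.log (1 + (m : ℝ) / n * (Real.exp (sieveEps n m ε) - 1)) = ε / 2 := by
  have hn : 0 < n := hm.trans_le hmn
  have : 0 < Real.exp (ε / 2) - 1 := sub_pos.2 (Real.one_lt_exp_iff.2 (by positivity))
  rw [sieveEps, Real.exp_log (by positivity)]
  have h : 1 + (m : ℝ) / n * ((n : ℝ) / m * (Real.exp (ε / 2) - 1) + 1 - 1) =
      Real.exp (ε / 2) := by
    field_simp
    ring
  rw [h, Real.log_exp]

theorem isPureDP_sieve {X : Type*} {n m q : ℕ} (hm : 0 < m) (hmn : m ≤ n)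
    (f : Fin q → Multiset X → ℝ) (T t : ℝ) {ε Δ : ℝ} (hε : 0 < ε) (hΔ : 0 < Δ)
    (hf : ∀ i, SensitivityLE m (f i) Δ) :
    IsPureDP (fun D : Dataset X n => sieve f T t m hmn ε Δ D) (ε / 2) := by
  have hε' := sieveEps_pos hm hmn hε
  rw [← log_amplified_sieveEps hm hmn hε]
  exact (isPureDP_aboveThreshold f (T - t) hε' hΔ hf).subsample_bind hm hmn hε'.le

theorem isPureDP_sieveAndExamine {X : Type*} {n m q : ℕ} (hm : 0 < m) (hmn : m ≤ n)
    (f : Fin q → Multiset X → ℝ) (T t : ℝ) {ε Δ : ℝ} (hε : 0 < ε) (hΔ : 0 < Δ)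
    (hfm : ∀ i, SensitivityLE m (f i) Δ) (hfn : ∀ i, SensitivityLE n (f i) Δ) :
    IsPureDP (fun D : Dataset X n => sieveAndExamine f T t m hmn ε Δ D) ε := by
  have h := (isPureDP_sieve (n := n) hm hmn f T t hε hΔ hfm).bind
    (B := fun r D => match r with
      | none => PMF.pure none
      | some k => examine f T ε Δ k D) (ε₂ := ε / 2) fun r => by
    cases r with
    -- After a failed sieve the output no longer depends on the data.
    | none => exact isPureDP_const _ (by positivity)
    | some k => exact isPureDP_examine f T hε hΔ k (hfn k)
  rwa [add_halves] at h

end SieveExamine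

theorem theorem1 {X : Type*} {n m q : ℕ} (hm : 0 < m) (hmn : m ≤ n)
    (f : Fin q → Multiset X → ℝ) (T t ε Δ : ℝ) (hε : 0 < ε) (hΔ : 0 < Δ)
    (hfm : ∀ i, SieveExamine.SensitivityLE m (f i) Δ)
    (hfn : ∀ i, SieveExamine.SensitivityLE n (f i) Δ) :
    -- AboveThreshold, run on datasets with `m` records, has privacy cost `ε'`
    SieveExamine.IsPureDP
      (fun D' : SieveExamine.Dataset X m =>
        SieveExamine.aboveThreshold f (T - t) (SieveExamine.sieveEps n m ε) Δ (D' : Multiset X))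
      (SieveExamine.sieveEps n m ε) ∧
    -- the sieve step (AboveThreshold on a subsample) has privacy cost `ε / 2`
    SieveExamine.IsPureDP
      (fun D : SieveExamine.Dataset X n => SieveExamine.sieve f T t m hmn ε Δ D) (ε / 2) ∧
    -- the examine step has privacy cost `ε / 2`
    (∀ k : Fin q, SieveExamine.IsPureDP
      (fun D : SieveExamine.Dataset X n => SieveExamine.examine f T ε Δ k D) (ε / 2)) ∧
    -- the whole mechanism is `ε`-differentially private
    SieveExamine.IsPureDP
      (fun D : SieveExamine.Dataset X n => SieveExamine.sieveAndExamine f T t m hmn ε Δ D) ε := by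
  exact ⟨SieveExamine.isPureDP_aboveThreshold f (T - t) (SieveExamine.sieveEps_pos hm hmn hε) hΔ
      hfm,
    SieveExamine.isPureDP_sieve hm hmn f T t hε hΔ hfm,
    fun k => SieveExamine.isPureDP_examine f T hε hΔ k (hfn k),
    SieveExamine.isPureDP_sieveAndExamine hm hmn f T t hε hΔ hfm hfn⟩
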